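/- For $d\ge 1$ let $\mathcal F_d(\Delta,L_1)$ be the set of $F\in C^1(\mathbb R^d,\mathbb R)$ that are bounded below, satisfy $F(0)-\inf F\le\Delta$, and have $\|\nabla F(x)-\nabla F(y)\|\le L_1\|x-y\|$ for all $x,y$ (Euclidean norm). For such $F$ let $\mathcal O(F)$ be the set of pairs of a probability distribution $\mathbb P_\xi$ on a measurable space and a jointly measurable map $g(x,\xi)\in\mathbb R^d$ such that for all $x,y\in\mathbb R^d$ $$\mathbb E\,g(x,\xi)=\nabla F(x),\qquad \mathbb E\|g(x,\xi)-\nabla F(x)\|^p\le\sigma_1^p,$$ $$\mathbb E\big\|[g(x,\xi)-g(y,\xi)]-[\nabla F(x)-\nabla F(y)]\big\|^q\le\delta^q\|x-y\|^q .$$ An algorithm draws a random seed $r$ once; in round $i=1,2,\dots$ it issues, as a measurable function of $r$ and of all earlier answers, a batch of $K\ge1$ points $x^{(i)}_1,\dots,x^{(i)}_K\in\mathbb R^d$, and receives the answers $\big(F(x^{(i)}_k),g(x^{(i)}_k,\xi^{(i)})\big)_{k\le K}$, where $\xi^{(1)},\xi^{(2)},\dots$ are i.i.d. with law $\mathbb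 P_\xi$ and independent of $r$. It is zero-respecting if, for every $F\in C^1(\mathbb R^d,\mathbb R)$ and every unbiased stochastic gradient oracle of $F$, almost surely for every $i$ each coordinate in which some point of the batch $x^{(i)}$ is nonzero is a coordinate in which some stochastic gradient received in rounds $1,\dots,i-1$ is nonzero; $\mathcal A_{\mathrm{zr}}(d,K)$ denotes the set of these algorithms. Let $T_\varepsilon(A,F,O)\in\{1,2,\dots\}\cup\{\infty\}$ be the first round $T$ such that $\mathbb E\|\nabla F(x^{(T)}_k)\|\le\varepsilon$ for some $k\le K$, when $A$ is run against the oracle $O$ of $F$, and let $$\mathfrak m^{\mathrm{zr}}_\varepsilon(K,L_1,\Delta,\delta,\sigma_1^p)=\sup_{d\ge1}\ \sup_{F\in\mathcal F_d(\Delta,L_1)}\ \sup_{O\in\mathcal O(F)}\ \inf_{A\in\mathcal A_{\mathrm{zr}}(d,K)}T_\varepsilon(A,F,O).$$ **Theorem.** There is a universal constant $c_1>0$ such that for all $p\in(1,2]$ and $q\in[1,2]$ there is a constant $C>0$, depending only on $p$ and $q$, with the following property. For all $K\ge1$, $\Delta,L_1,\delta>0$, $\sigma_1\ge0$ and $0<\varepsilon\le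 c_1\sqrt{L_1\Delta}$, put $$R=\min\left\{\frac{L_1\Delta}{\varepsilon^2}+\frac{L_1\Delta}{\varepsilon^2}\Big(\frac{\sigma_1}{\varepsilon}\Big)^{\frac p{p-1}},\ \Big(\frac{\sigma_1}{\varepsilon}\Big)^{\frac p{p-1}}+\frac{(L_1+\delta)\Delta}{\varepsilon^2}+\frac{\delta\Delta}{\varepsilon^2}\Big(\frac{\sigma_1}{\varepsilon}\Big)^{\frac p{q(p-1)}}\right\}.$$ Then there are $d\ge1$, $F\in\mathcal F_d(\Delta,L_1)$ and $O\in\mathcal O(F)$ such that $T_\varepsilon(A,F,O)\ge C\,R$ for every $A\in\mathcal A_{\mathrm{zr}}(d,K)$; and, consequently, $\mathfrak m^{\mathrm{zr}}_\varepsilon(K,L_1,\Delta,\delta,\sigma_1^p)\ge C\,R$. -/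

import Mathlib

open MeasureTheory
open scoped ENNReal

universe u

noncomputable section

/-- The space `ℝ^d` with its Euclidean norm. -/
abbrev Vec (d : ℕ) : Type := EuclideanSpace ℝ (Fin d)

/-- The set of indices of the nonzero coordinates of a vector. -/
def vecSupport {d : ℕ} (x : Vec d) : Set (Fin d) := {c | x c ≠ 0}

/-- The class of continuously differentiable functions that are bounded below, have initial
suboptimality at most `Δ` at the origin, and have an `L₁`-Lipschitz gradient. -/
def FunctionClass (d : ℕ) (Δ L₁ : ℝ) : Set (Vec d → ℝ) :=
  {F | ContDiff ℝ 1 F ∧ BddBelow (Set.range F) ∧ F 0 - ⨅ x, F x ≤ Δ ∧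
    ∀ x y, ‖gradient F x - gradient F y‖ ≤ L₁ * ‖x - y‖}

/-- A stochastic first-order oracle for `F`: a probability distribution on a measurable space,
together with a (jointly measurable) unbiased estimator of the gradient of `F`. -/
structure StochasticOracle {d : ℕ} (F : Vec d → ℝ) where
  Sample : Type
  [measurableSpaceSample : MeasurableSpace Sample]
  law : Measure Sample
  [isProbabilityMeasure_law : IsProbabilityMeasure law]
  grad : Vec d → Sample → Vec d
  measurable_grad : Measurable (fun z : Vec d × Sample => grad z.1 z.2)
  integrable_grad : ∀ x, Integrable (grad x) law
  unbiased : ∀ x, ∫ ξ, grad x ξ ∂law = gradient F x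

attribute [instance] StochasticOracle.measurableSpaceSample
attribute [instance] StochasticOracle.isProbabilityMeasure_law

/-- The `p`-th central moment of the stochastic gradient is at most `σ₁ ^ p` at every point. -/
def StochasticOracle.BoundedCentralMoment {d : ℕ} {F : Vec d → ℝ} (O : StochasticOracle F)
    (p σ₁ : ℝ) : Prop :=
  ∀ x, ∫⁻ ξ, ‖O.grad x ξ - gradient F x‖ₑ ^ p ∂O.law ≤ ENNReal.ofReal (σ₁ ^ p)

/-- `(q, δ)`-similarity of the stochastic gradient and the gradient. -/
def StochasticOracle.Similarity {d : ℕ} {F : Vec d → ℝ} (O : StochasticOracle F)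
    (q δ : ℝ) : Prop :=
  ∀ x y, ∫⁻ ξ, ‖(O.grad x ξ - O.grad y ξ) - (gradient F x - gradient F y)‖ₑ ^ q ∂O.law
    ≤ ENNReal.ofReal (δ ^ q * ‖x - y‖ ^ q)

/-- The class of stochastic first-order oracles for `F` with `p`-th central moment at most
`σ₁ ^ p` and `(q, δ)`-similarity. -/
def OracleClass {d : ℕ} (F : Vec d → ℝ) (p σ₁ q δ : ℝ) : Set (StochasticOracle F) :=
  {O | O.BoundedCentralMoment p σ₁ ∧ O.Similarity q δ}

/-- A batch of `K` query points. -/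
abbrev Batch (d K : ℕ) : Type := Fin K → Vec d

/-- The answer to a batch: a function value and a stochastic gradient for each point. -/
abbrev Response (d K : ℕ) : Type := Fin K → ℝ × Vec d

/-- The answer of the oracle to a batch; the same sample `ξ` is used for all points of it. -/
def StochasticOracle.respond {d K : ℕ} {F : Vec d → ℝ} (O : StochasticOracle F)
    (x : Batch d K) (ξ : O.Sample) : Response d K :=
  fun k => (F (x k), O.grad (x k) ξ)

/-- A randomized algorithm that issues `K` queries per round: a random seed, drawn once, and for
each `i` a measurable map that produces the next batch from the `i` previous answers and the
seed. -/
structure RandomizedAlgorithm (d K : ℕ) where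
  Seed : Type u
  [measurableSpaceSeed : MeasurableSpace Seed]
  seedLaw : Measure Seed
  [isProbabilityMeasure_seedLaw : IsProbabilityMeasure seedLaw]
  next : (i : ℕ) → (Fin i → Response d K) → Seed → Batch d K
  measurable_next : ∀ i, Measurable
    (fun z : (Fin i → Response d K) × Seed => next i z.1 z.2)

attribute [instance] RandomizedAlgorithm.measurableSpaceSeed
attribute [instance] RandomizedAlgorithm.isProbabilityMeasure_seedLaw

namespace RandomizedAlgorithm

variable {d K : ℕ} {F : Vec d → ℝ}

/-- The batches issued by the algorithm against the oracle, given the seed `r` and the samples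
`ξ 0, ξ 1, …` of the successive rounds. Rounds are numbered from `0`: `A.query O r ξ i` is the
batch that the algorithm issues after it has received `i` answers. -/
def query (A : RandomizedAlgorithm.{u} d K) (O : StochasticOracle F) (r : A.Seed)
    (ξ : ℕ → O.Sample) (i : ℕ) : Batch d K :=
  A.next i (fun j : Fin i => O.respond (A.query O r ξ j) (ξ j)) r
termination_by i
decreasing_by exact j.2

/-- The joint law of the seed and of the samples of all rounds, which are independent. -/
def runLaw (A : RandomizedAlgorithm.{u} d K) (O : StochasticOracle F) :
    Measure (A.Seed × (ℕ → O.Sample)) :=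
  A.seedLaw.prod (Measure.infinitePi fun _ : ℕ => O.law)

/-- An algorithm is zero-respecting if, against every oracle of every continuously differentiable
function, almost surely the support of each batch is contained in the union of the supports of
the stochastic gradients received before. -/
def ZeroRespecting (A : RandomizedAlgorithm.{u} d K) : Prop :=
  ∀ F : Vec d → ℝ, ContDiff ℝ 1 F → ∀ O : StochasticOracle F,
    ∀ᵐ ω ∂(A.runLaw O), ∀ i : ℕ,
      (⋃ k : Fin K, vecSupport (A.query O ω.1 ω.2 i k)) ⊆
        ⋃ j : Fin i, ⋃ k : Fin K,
          vecSupport (O.respond (A.query O ω.1 ω.2 j) (ω.2 j) k).2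

/-- The first round `T ≥ 1` whose batch contains a point `x` with `𝔼 ‖∇F(x)‖ ≤ ε`
(`∞` if there is no such round). -/
def complexity (A : RandomizedAlgorithm.{u} d K) (O : StochasticOracle F) (ε : ℝ) : ℝ≥0∞ :=
  ⨅ (i : ℕ) (_ : ∃ k : Fin K,
      ∫⁻ ω, ‖gradient F (A.query O ω.1 ω.2 i k)‖ₑ ∂(A.runLaw O) ≤ ENNReal.ofReal ε),
    ((i + 1 : ℕ) : ℝ≥0∞)

end RandomizedAlgorithm

/-- The class of zero-respecting algorithms with `K` queries per round. -/
def ZeroRespectingClass (d K : ℕ) : Set (RandomizedAlgorithm.{u} d K) :=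
  {A | A.ZeroRespecting}

/-- The complexity of finding an `ε`-stationary point with zero-respecting algorithms: the
supremum, over the dimension, the function class and the oracle class, of the infimum, over the
zero-respecting algorithms, of the number of rounds. -/
def zeroRespectingComplexity (K : ℕ) (p q ε L₁ Δ δ σ₁ : ℝ) : ℝ≥0∞ :=
  ⨆ (d : ℕ) (_ : 1 ≤ d) (F ∈ FunctionClass d Δ L₁) (O ∈ OracleClass F p σ₁ q δ),
    ⨅ A ∈ ZeroRespectingClass.{u} d K, A.complexity O ε

/-- The minimum of the two rates in the lower bound. -/
def lowerRate (p q ε L₁ Δ δ σ₁ : ℝ) : ℝ :=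
  min (L₁ * Δ / ε ^ 2 + L₁ * Δ / ε ^ 2 * (σ₁ / ε) ^ (p / (p - 1)))
    ((σ₁ / ε) ^ (p / (p - 1)) + (L₁ + δ) * Δ / ε ^ 2 +
      δ * Δ / ε ^ 2 * (σ₁ / ε) ^ (p / (q * (p - 1))))

end

/-! The lower bound comes from a zero-chain: a function `chain` in which coordinate `i` of the
gradient at a vector supported on an initial segment can be nonzero beyond that segment only at the
very next coordinate. Its gradient, after scaling, has norm at least `2 * ε` as long as the last
coordinate is zero. A zero-respecting algorithm therefore has to discover all coordinates one after
another.

The oracle adds `(b / θ - 1) • N x` with `b` Bernoulli of parameter `θ`, where the field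
`chainNoise` equals the gradient in all undiscovered coordinates. With probability `1 - θ` the
factor is `-1` and the next coordinate stays hidden, so about `d / θ` rounds are needed
(`RandomizedAlgorithm.le_complexity_of_progress`). One sample serves a whole batch, hence `K` plays
no role.

With `s = (σ₁ / ε) ^ (p / (p - 1))`, the moment bound allows `θ` of order `1 / s`. Similarity
restricts the smoothness `L` of the chain to `δ * θ ^ ((q - 1) / q)`, and the gap `Δ` allows a
length of order `L * Δ / ε ^ 2`. Three instances result: a noiseless chain with the full `L₁`
(`hardInstance_noiseless`), a single coordinate with constant noise, worth `s` rounds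
(`hardInstance_single`), and a noisy chain, worth `L * Δ / ε ^ 2 * s` rounds (`hardInstance_chain`).
The rate is bounded by a multiple of the largest of the three. -/

noncomputable section

/-! ### Discovery of coordinates by zero-respecting algorithms -/

section Progress

variable {d K : ℕ} {F : Vec d → ℝ}

/-- All points of a batch share one sample, so a round advances the discovered initial segment by at
most `w` of that sample, however large `K` is. -/
theorem RandomizedAlgorithm.query_support_lt {A : RandomizedAlgorithm.{u} d K}
    {O : StochasticOracle F} (w : O.Sample → ℕ)
    (hstep : ∀ x ξ m, (∀ c, x c ≠ 0 → c.val < m) →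
      ∀ c, O.grad x ξ c ≠ 0 → c.val < m + w ξ)
    {ω : A.Seed × (ℕ → O.Sample)}
    (hω : ∀ i : ℕ, (⋃ k : Fin K, vecSupport (A.query O ω.1 ω.2 i k)) ⊆
        ⋃ j : Fin i, ⋃ k : Fin K,
          vecSupport (O.respond (A.query O ω.1 ω.2 j) (ω.2 j) k).2)
    (i : ℕ) (k : Fin K) (c : Fin d) (hc : A.query O ω.1 ω.2 i k c ≠ 0) :
    c.val < ∑ l ∈ Finset.range i, w (ω.2 l) := by
  induction i using Nat.strong_induction_on generalizing k c with
  | _ i ih =>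
    have h := hω i (Set.mem_iUnion.2 ⟨k, hc⟩)
    obtain ⟨j, hj⟩ := Set.mem_iUnion.1 h
    obtain ⟨k', hk'⟩ := Set.mem_iUnion.1 hj
    have h1 := hstep (A.query O ω.1 ω.2 j k') (ω.2 j) _ (fun c hc => ih j j.2 k' c hc) c hk'
    rw [← Finset.sum_range_succ (fun l => w (ω.2 l))] at h1
    exact h1.trans_le (Finset.sum_le_sum_of_subset (Finset.range_mono j.2))

theorem RandomizedAlgorithm.lintegral_sum_eval (A : RandomizedAlgorithm.{u} d K)
    (O : StochasticOracle F) {w : O.Sample → ℕ} (hw : Measurable w) (i : ℕ) :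
    ∫⁻ ω, ((∑ l ∈ Finset.range i, w (ω.2 l) : ℕ) : ℝ≥0∞) ∂(A.runLaw O) =
      i * ∫⁻ ξ, (w ξ : ℝ≥0∞) ∂O.law := by
  have hm : Measurable fun ξ => (w ξ : ℝ≥0∞) := by fun_prop
  have key : ∀ l : ℕ, ∫⁻ ω, (w (ω.2 l) : ℝ≥0∞) ∂(A.runLaw O) =
      ∫⁻ ξ, (w ξ : ℝ≥0∞) ∂O.law := by
    intro l
    have h1 : MeasurePreserving (fun ω : A.Seed × (ℕ → O.Sample) => ω.2 l)
        (A.runLaw O) O.law :=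
      (measurePreserving_eval_infinitePi (fun _ : ℕ => O.law) l).comp measurePreserving_snd
    exact h1.lintegral_comp hm
  push_cast
  rw [lintegral_finsetSum _ (fun l _ => by fun_prop)]
  simp [key]

/-- If the samples reveal, in the mean, at most `θ` new coordinates per round, and the gradient is
at least `2 * ε` until all coordinates are revealed, then a zero-respecting algorithm needs at
least `d / (2 * θ)` rounds. -/
theorem RandomizedAlgorithm.le_complexity_of_progress (hF : ContDiff ℝ 1 F)
    (O : StochasticOracle F) {w : O.Sample → ℕ} (hw : Measurable w) {θ ε : ℝ} (hθ : 0 < θ)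
    (hε : 0 < ε) (hmean : ∫⁻ ξ, (w ξ : ℝ≥0∞) ∂O.law ≤ ENNReal.ofReal θ)
    (hstep : ∀ x ξ m, (∀ c, x c ≠ 0 → c.val < m) →
      ∀ c, O.grad x ξ c ≠ 0 → c.val < m + w ξ)
    (hgrad : ∀ x : Vec d, (∀ c, x c ≠ 0 → c.val + 1 < d) → 2 * ε ≤ ‖gradient F x‖)
    {A : RandomizedAlgorithm.{u} d K} (hA : A.ZeroRespecting) :
    ENNReal.ofReal (d / (2 * θ)) ≤ A.complexity O ε := by
  refine le_iInf₂ fun i hi => ?_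
  obtain ⟨k, hk⟩ := hi
  by_contra! hlt
  have hi : (i : ℝ) * θ < d / 2 := by
    have h1 : ENNReal.ofReal ((i : ℝ) + 1) < ENNReal.ofReal (d / (2 * θ)) := by
      rw [ENNReal.ofReal_add (by positivity) zero_le_one]
      simpa using hlt
    have h2 := (ENNReal.ofReal_lt_ofReal_iff_of_nonneg (by positivity)).1 h1
    rw [lt_div_iff₀ (by positivity)] at h2
    nlinarith
  have hd : (0 : ℝ) < d := by nlinarith [mul_nonneg (Nat.cast_nonneg (α := ℝ) i) hθ.le]
  have hprob : IsProbabilityMeasure (A.runLaw O) := by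
    unfold RandomizedAlgorithm.runLaw; infer_instance
  set μ := A.runLaw O
  let S : A.Seed × (ℕ → O.Sample) → ℕ := fun ω => ∑ l ∈ Finset.range i, w (ω.2 l)
  have hS : Measurable S := by fun_prop
  have hset : MeasurableSet {ω | d ≤ S ω} := measurableSet_le measurable_const hS
  -- Markov's inequality: the expected progress `i * θ` is below `d / 2`.
  have hbad : μ.real {ω | d ≤ S ω} < 1 / 2 := by
    have h1 : (d : ℝ≥0∞) * μ {ω | (d : ℝ≥0∞) ≤ (S ω : ℝ≥0∞)} ≤ ENNReal.ofReal (i * θ) := by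
      refine (mul_meas_ge_le_lintegral (by fun_prop) _).trans ?_
      rw [A.lintegral_sum_eval O hw, ENNReal.ofReal_mul (by positivity), ENNReal.ofReal_natCast]
      gcongr
    simp only [Nat.cast_le] at h1
    have h2 := ENNReal.toReal_mono ENNReal.ofReal_ne_top h1
    rw [ENNReal.toReal_mul, ENNReal.toReal_natCast, ENNReal.toReal_ofReal (by positivity)] at h2
    change (d : ℝ) * μ.real _ ≤ _ at h2
    nlinarith
  have hgood : 1 / 2 < μ.real {ω | d ≤ S ω}ᶜ := by
    rw [probReal_compl_eq_one_sub hset]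
    linarith
  -- Off the bad event the last coordinate is still zero. The gradient is then at least `2 * ε` with
  -- probability above `1 / 2`, so its mean exceeds `ε`.
  have hlow : ENNReal.ofReal (2 * ε) * μ {ω | d ≤ S ω}ᶜ ≤ ENNReal.ofReal ε := by
    refine le_trans ?_ hk
    rw [← lintegral_indicator_const hset.compl]
    refine lintegral_mono_ae ?_
    filter_upwards [hA F hF O] with ω hω
    by_cases hb : d ≤ S ω
    · simp [hb]
    · rw [Set.indicator_of_mem (by simpa using hb), ← ofReal_norm]
      refine ENNReal.ofReal_le_ofReal (hgrad _ fun c hc => ?_)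
      have h1 : c.val < S ω := RandomizedAlgorithm.query_support_lt w hstep hω i k c hc
      omega
  have h3 := ENNReal.toReal_mono ENNReal.ofReal_ne_top hlow
  rw [ENNReal.toReal_mul, ENNReal.toReal_ofReal (by positivity),
    ENNReal.toReal_ofReal hε.le] at h3
  change 2 * ε * μ.real _ ≤ _ at h3
  nlinarith

end Progress

/-! ### Bernoulli noise and its moments -/

section TwoPoint

/-- The Bernoulli distribution with success probability `θ`. -/
def bernoulliLaw (θ : ℝ) : Measure Bool :=
  ENNReal.ofReal θ • Measure.dirac true + ENNReal.ofReal (1 - θ) • Measure.dirac false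

theorem isProbabilityMeasure_bernoulliLaw {θ : ℝ} (h0 : 0 ≤ θ) (h1 : θ ≤ 1) :
    IsProbabilityMeasure (bernoulliLaw θ) := by
  constructor
  simp only [bernoulliLaw, Measure.coe_add, Measure.coe_smul, Pi.add_apply, Pi.smul_apply,
    measure_univ, smul_eq_mul, mul_one]
  rw [← ENNReal.ofReal_add h0 (by linarith)]
  simp

theorem lintegral_bernoulliLaw (θ : ℝ) (f : Bool → ℝ≥0∞) :
    ∫⁻ b, f b ∂(bernoulliLaw θ) =
      ENNReal.ofReal θ * f true + ENNReal.ofReal (1 - θ) * f false := by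
  simp [bernoulliLaw, lintegral_add_measure, lintegral_smul_measure]

theorem integral_bernoulliLaw {E : Type*} [NormedAddCommGroup E] [NormedSpace ℝ E]
    [CompleteSpace E] {θ : ℝ} (h0 : 0 ≤ θ) (h1 : θ ≤ 1) (f : Bool → E) :
    ∫ b, f b ∂(bernoulliLaw θ) = θ • f true + (1 - θ) • f false := by
  have hfin : ∀ (t : ℝ) (b : Bool), IsFiniteMeasure (ENNReal.ofReal t • Measure.dirac b) :=
    fun t b => Measure.smul_finite _ ENNReal.ofReal_ne_top
  have := hfin θ true
  have := hfin (1 - θ) false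
  rw [bernoulliLaw, integral_add_measure (.of_finite) (.of_finite)]
  simp [integral_smul_measure, ENNReal.toReal_ofReal, h0, h1]

/-- The centred noise factor `ξ / θ - 1` for a Bernoulli variable `ξ`. -/
def noiseFactor (θ : ℝ) (b : Bool) : ℝ := (if b then θ⁻¹ else 0) - 1

/-- The value `θ⁻¹ - 1 ≤ θ⁻¹` has probability `θ` and contributes at most `c ^ r * θ ^ (1 - r)`; the
value `-1` contributes at most `c ^ r`, which is no larger since `θ ≤ 1`. -/
theorem lintegral_noiseFactor_smul_le {E : Type*} [NormedAddCommGroup E] [NormedSpace ℝ E]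
    {θ r c : ℝ} (h0 : 0 < θ) (h1 : θ ≤ 1) (hr : 1 ≤ r) {v : E} (hv : ‖v‖ ≤ c) :
    ∫⁻ b, ‖noiseFactor θ b • v‖ₑ ^ r ∂(bernoulliLaw θ) ≤
      ENNReal.ofReal (2 * c ^ r * θ ^ (1 - r)) := by
  have hc : 0 ≤ c := (norm_nonneg v).trans hv
  have hconv : ∀ u : E, ‖u‖ₑ ^ r = ENNReal.ofReal (‖u‖ ^ r) := fun u => by
    rw [← ofReal_norm, ENNReal.ofReal_rpow_of_nonneg (norm_nonneg _) (by linarith)]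
  have hinv : 1 ≤ θ⁻¹ := (one_le_inv₀ h0).2 h1
  rw [lintegral_bernoulliLaw, hconv, hconv, ← ENNReal.ofReal_mul h0.le,
    ← ENNReal.ofReal_mul (by linarith), ← ENNReal.ofReal_add (by positivity)
      (mul_nonneg (by linarith) (by positivity))]
  apply ENNReal.ofReal_le_ofReal
  have e1 : ‖noiseFactor θ true • v‖ ≤ θ⁻¹ * c := by
    rw [norm_smul]
    refine mul_le_mul ?_ hv (norm_nonneg _) (by positivity)
    simp only [noiseFactor, if_true, Real.norm_eq_abs]
    rw [abs_of_nonneg (by linarith)]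
    linarith
  have e2 : ‖noiseFactor θ false • v‖ ≤ c := by
    simpa [noiseFactor] using hv
  have p1 : ‖noiseFactor θ true • v‖ ^ r ≤ (θ⁻¹ * c) ^ r :=
    Real.rpow_le_rpow (norm_nonneg _) e1 (by linarith)
  have p2 : ‖noiseFactor θ false • v‖ ^ r ≤ c ^ r :=
    Real.rpow_le_rpow (norm_nonneg _) e2 (by linarith)
  have hcr : 0 ≤ c ^ r := by positivity
  have hpow : θ * (θ⁻¹ * c) ^ r = c ^ r * θ ^ (1 - r) := by
    rw [Real.mul_rpow (by positivity) hc, Real.inv_rpow h0.le, Real.rpow_sub h0, Real.rpow_one]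
    ring
  have hge : 1 ≤ θ ^ (1 - r) := Real.one_le_rpow_of_pos_of_le_one_of_nonpos h0 h1 (by linarith)
  have q1 : θ * ‖noiseFactor θ true • v‖ ^ r ≤ c ^ r * θ ^ (1 - r) := by
    rw [← hpow]; gcongr
  have q2 : (1 - θ) * ‖noiseFactor θ false • v‖ ^ r ≤ 1 * c ^ r :=
    mul_le_mul (by linarith) p2 (by positivity) zero_le_one
  nlinarith

variable {d : ℕ} {F : Vec d → ℝ}

/-- The oracle that perturbs the gradient by the vector field `N`, multiplied with a centred
Bernoulli variable. -/
def bernoulliOracle (hF : Continuous (gradient F)) {N : Vec d → Vec d} (hN : Continuous N)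
    {θ : ℝ} (h0 : 0 < θ) (h1 : θ ≤ 1) : StochasticOracle F :=
  haveI := isProbabilityMeasure_bernoulliLaw h0.le h1
  { Sample := Bool
    law := bernoulliLaw θ
    grad := fun x b => gradient F x + noiseFactor θ b • N x
    measurable_grad := by
      refine measurable_from_prod_countable_left fun b => ?_
      exact (hF.add (hN.const_smul (noiseFactor θ b))).measurable
    integrable_grad := fun x => .of_finite
    unbiased := fun x => by
      rw [integral_bernoulliLaw h0.le h1]
      simp only [noiseFactor, if_true, Bool.false_eq_true, if_false]
      have h2 : (θ * (θ⁻¹ - 1) + (1 - θ) * (0 - 1)) = 0 := by field_simp; ring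
      calc _ = gradient F x + (θ * (θ⁻¹ - 1) + (1 - θ) * (0 - 1)) • N x := by module
        _ = _ := by rw [h2]; simp }

theorem bernoulliOracle_mem_oracleClass (hF : Continuous (gradient F)) {N : Vec d → Vec d}
    (hN : Continuous N) {θ : ℝ} (h0 : 0 < θ) (h1 : θ ≤ 1) {p q σ δ c ℓ : ℝ} (hp : 1 ≤ p)
    (hq : 1 ≤ q) (hℓ : 0 ≤ ℓ) (hbd : ∀ x, ‖N x‖ ≤ c)
    (hlip : ∀ x y, ‖N x - N y‖ ≤ ℓ * ‖x - y‖)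
    (hσ : 2 * c ^ p * θ ^ (1 - p) ≤ σ ^ p) (hδ : 2 * ℓ ^ q * θ ^ (1 - q) ≤ δ ^ q) :
    bernoulliOracle hF hN h0 h1 ∈ OracleClass F p σ q δ := by
  constructor
  · intro x
    change ∫⁻ b, ‖gradient F x + noiseFactor θ b • N x - gradient F x‖ₑ ^ p
      ∂(bernoulliLaw θ) ≤ _
    simp only [add_sub_cancel_left]
    exact (lintegral_noiseFactor_smul_le h0 h1 hp (hbd x)).trans (ENNReal.ofReal_le_ofReal hσ)
  · intro x y
    change ∫⁻ b, ‖(gradient F x + noiseFactor θ b • N x) - (gradient F y + noiseFactor θ b • N y)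
      - (gradient F x - gradient F y)‖ₑ ^ q ∂(bernoulliLaw θ) ≤ _
    have e : ∀ b, (gradient F x + noiseFactor θ b • N x) - (gradient F y + noiseFactor θ b • N y)
      - (gradient F x - gradient F y) = noiseFactor θ b • (N x - N y) := fun b => by module
    simp only [e]
    refine (lintegral_noiseFactor_smul_le h0 h1 hq (hlip x y)).trans
      (ENNReal.ofReal_le_ofReal ?_)
    rw [Real.mul_rpow hℓ (norm_nonneg _)]
    calc _ = (2 * ℓ ^ q * θ ^ (1 - q)) * ‖x - y‖ ^ q := by ring
      _ ≤ _ := by gcongr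

end TwoPoint

/-! ### One-dimensional building blocks -/

section Ramp

/-- The convex quadratic ramp `max(t, 0)² / 2`. -/
def sqRamp (t : ℝ) : ℝ := max t 0 ^ 2 / 2

theorem sqRamp_of_nonneg {t : ℝ} (h : 0 ≤ t) : sqRamp t = t ^ 2 / 2 := by simp [sqRamp, h]

theorem sqRamp_of_nonpos {t : ℝ} (h : t ≤ 0) : sqRamp t = 0 := by simp [sqRamp, h]

theorem sqRamp_nonneg (t : ℝ) : 0 ≤ sqRamp t := by unfold sqRamp; positivity

theorem hasDerivAt_sqRamp (t : ℝ) : HasDerivAt sqRamp (max t 0) t := by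
  rcases lt_trichotomy t 0 with h | rfl | h
  · rw [max_eq_right h.le]
    refine (hasDerivAt_const t (0 : ℝ)).congr_of_eventuallyEq ?_
    filter_upwards [Iio_mem_nhds h] with s hs using sqRamp_of_nonpos (le_of_lt hs)
  · rw [max_self, hasDerivAt_iff_isLittleO]
    simp only [sqRamp_of_nonpos le_rfl, sub_zero, smul_zero]
    have h1 : (fun t : ℝ => t ^ 2) =o[nhds 0] fun t : ℝ => t := by
      simpa using Asymptotics.isLittleO_pow_id (𝕜 := ℝ) (n := 2) (by norm_num)
    refine Asymptotics.IsBigO.trans_isLittleO (.of_bound 1 (.of_forall fun t => ?_)) h1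
    rw [Real.norm_of_nonneg (sqRamp_nonneg t), Real.norm_of_nonneg (sq_nonneg t)]
    rcases le_total t 0 with h | h
    · rw [sqRamp_of_nonpos h]; positivity
    · rw [sqRamp_of_nonneg h]; nlinarith [sq_nonneg t]
  · rw [max_eq_left h.le]
    have h1 : HasDerivAt (fun t : ℝ => t ^ 2 / 2) t t := by
      simpa using ((hasDerivAt_id t).pow 2).div_const 2
    refine h1.congr_of_eventuallyEq ?_
    filter_upwards [Ioi_mem_nhds h] with s hs using sqRamp_of_nonneg (le_of_lt hs)

theorem contDiff_sqRamp : ContDiff ℝ 1 sqRamp := by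
  rw [contDiff_one_iff_deriv]
  refine ⟨fun t => (hasDerivAt_sqRamp t).differentiableAt, ?_⟩
  rw [show deriv sqRamp = fun t => max t 0 from funext fun t => (hasDerivAt_sqRamp t).deriv]
  fun_prop

/-- A `C¹` step from `0` on `(-∞, 1]` to `1` on `[3, ∞)`. -/
def smoothStep (u : ℝ) : ℝ := sqRamp (u - 1) - 2 * sqRamp (u - 2) + sqRamp (u - 3)

/-- The derivative of `smoothStep`. -/
def tent (u : ℝ) : ℝ := max 0 (min (u - 1) (3 - u))

/-- A `C¹` step from `0` on `(-∞, -1]` to `4` on `[4, ∞)`, with slope `1` on `[0, 3]`. -/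
def wideStep (v : ℝ) : ℝ := sqRamp (v + 1) - sqRamp v - sqRamp (v - 3) + sqRamp (v - 4)

/-- The derivative of `wideStep`. -/
def trapezoid (v : ℝ) : ℝ := max 0 (min 1 (min (v + 1) (4 - v)))

theorem hasDerivAt_smoothStep (u : ℝ) : HasDerivAt smoothStep (tent u) u := by
  have h := fun a : ℝ => (hasDerivAt_sqRamp (u - a)).comp_sub_const u a
  refine (((h 1).sub ((h 2).const_mul 2)).add (h 3)).congr_deriv ?_
  unfold tent
  grind

theorem hasDerivAt_wideStep (v : ℝ) : HasDerivAt wideStep (trapezoid v) v := by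
  have h := fun a : ℝ => (hasDerivAt_sqRamp (v - a)).comp_sub_const v a
  refine (((((hasDerivAt_sqRamp (v + 1)).comp_add_const v 1).sub (hasDerivAt_sqRamp v)).sub
    (h 3)).add (h 4)).congr_deriv ?_
  unfold trapezoid
  grind

theorem contDiff_smoothStep : ContDiff ℝ 1 smoothStep := by
  have := contDiff_sqRamp
  unfold smoothStep
  fun_prop

theorem contDiff_wideStep : ContDiff ℝ 1 wideStep := by
  have := contDiff_sqRamp
  unfold wideStep
  fun_prop

theorem tent_nonneg (u : ℝ) : 0 ≤ tent u := le_max_left _ _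

theorem tent_le_one (u : ℝ) : tent u ≤ 1 := by unfold tent; grind

theorem abs_tent_sub_le (u v : ℝ) : |tent u - tent v| ≤ |u - v| := by unfold tent; grind

theorem tent_zero : tent 0 = 0 := by norm_num [tent]

theorem trapezoid_nonneg (v : ℝ) : 0 ≤ trapezoid v := le_max_left _ _

theorem trapezoid_le_one (v : ℝ) : trapezoid v ≤ 1 := by unfold trapezoid; grind

theorem abs_trapezoid_sub_le (u v : ℝ) : |trapezoid u - trapezoid v| ≤ |u - v| := by
  unfold trapezoid; grind

theorem trapezoid_zero : trapezoid 0 = 1 := by norm_num [trapezoid]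

/-- The quadratic ramp takes over where the trapezoid fades: `(v + 1) - v = 1` on `[-1, 0]`, and `-v
≥ 1` further left. Negative coordinates thus cannot make the gradient small. -/
theorem one_le_trapezoid_sub_min {v : ℝ} (hv : v ≤ 3) : 1 ≤ trapezoid v - min v 0 := by
  unfold trapezoid; grind

theorem smoothStep_of_le_one {u : ℝ} (hu : u ≤ 1) : smoothStep u = 0 := by
  simp [smoothStep, sqRamp_of_nonpos, hu, show u ≤ 2 by linarith, show u ≤ 3 by linarith]

theorem smoothStep_of_three_le {u : ℝ} (hu : 3 ≤ u) : smoothStep u = 1 := by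
  rw [smoothStep, sqRamp_of_nonneg (by linarith), sqRamp_of_nonneg (by linarith),
    sqRamp_of_nonneg (by linarith)]
  ring

theorem smoothStep_monotone : Monotone smoothStep :=
  monotone_of_deriv_nonneg (fun u => (hasDerivAt_smoothStep u).differentiableAt)
    fun u => by rw [(hasDerivAt_smoothStep u).deriv]; exact tent_nonneg u

theorem smoothStep_nonneg (u : ℝ) : 0 ≤ smoothStep u :=
  (smoothStep_of_le_one (min_le_right u 1)).symm.le.trans (smoothStep_monotone (min_le_left u 1))

theorem smoothStep_le_one (u : ℝ) : smoothStep u ≤ 1 :=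
  (smoothStep_monotone (le_max_left u 3)).trans (smoothStep_of_three_le (le_max_right u 3)).le

theorem abs_smoothStep_sub_le (u v : ℝ) : |smoothStep u - smoothStep v| ≤ |u - v| := by
  have h := convex_univ.norm_image_sub_le_of_norm_hasDerivWithin_le (C := 1)
    (fun x _ => (hasDerivAt_smoothStep x).hasDerivWithinAt)
    (fun x _ => by rw [Real.norm_of_nonneg (tent_nonneg x)]; exact tent_le_one x)
    (Set.mem_univ v) (Set.mem_univ u)
  simpa using h

theorem wideStep_monotone : Monotone wideStep :=
  monotone_of_deriv_nonneg (fun u => (hasDerivAt_wideStep u).differentiableAt)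
    fun u => by rw [(hasDerivAt_wideStep u).deriv]; exact trapezoid_nonneg u

theorem wideStep_nonneg (v : ℝ) : 0 ≤ wideStep v := by
  refine le_trans (le_of_eq ?_) (wideStep_monotone (min_le_left v (-1)))
  have h := min_le_right v (-1)
  rw [wideStep, sqRamp_of_nonpos (by linarith), sqRamp_of_nonpos (by linarith),
    sqRamp_of_nonpos (by linarith), sqRamp_of_nonpos (by linarith)]
  ring

theorem wideStep_le_four (v : ℝ) : wideStep v ≤ 4 := by
  refine (wideStep_monotone (le_max_left v 4)).trans (le_of_eq ?_)
  have h := le_max_right v 4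
  rw [wideStep, sqRamp_of_nonneg (by linarith), sqRamp_of_nonneg (by linarith),
    sqRamp_of_nonneg (by linarith), sqRamp_of_nonneg (by linarith)]
  ring

theorem abs_wideStep_sub_le (u v : ℝ) : |wideStep u - wideStep v| ≤ |u - v| := by
  have h := convex_univ.norm_image_sub_le_of_norm_hasDerivWithin_le (C := 1)
    (fun x _ => (hasDerivAt_wideStep x).hasDerivWithinAt)
    (fun x _ => by rw [Real.norm_of_nonneg (trapezoid_nonneg x)]; exact trapezoid_le_one x)
    (Set.mem_univ v) (Set.mem_univ u)
  simpa using h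

theorem abs_mul_sub_mul_le (a b a' b' : ℝ) :
    |a * b - a' * b'| ≤ |a - a'| * |b| + |a'| * |b - b'| := by
  rw [← abs_mul, ← abs_mul, show a * b - a' * b' = (a - a') * b + a' * (b - b') by ring]
  exact abs_add_le _ _

end Ramp

/-! ### The zero-chain and its gradient -/

section Chain

variable {d : ℕ}

/-- The `n`-th node of the chain: the value `3` at `0`, then the coordinates of `x`, then `0`. -/
def node (x : Vec d) : ℕ → ℝ
  | 0 => 3
  | n + 1 => if h : n < d then x ⟨n, h⟩ else 0

/-- The linear part of `node`. -/
def nodeDeriv (d : ℕ) : ℕ → (Vec d →L[ℝ] ℝ)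
  | 0 => 0
  | n + 1 => if h : n < d then EuclideanSpace.proj ⟨n, h⟩ else 0

@[simp] theorem node_zero (x : Vec d) : node x 0 = 3 := rfl

@[simp] theorem node_succ (x : Vec d) (i : Fin d) : node x (i + 1) = x i := by simp [node]

@[simp] theorem nodeDeriv_zero (v : Vec d) : nodeDeriv d 0 v = 0 := rfl

@[simp] theorem nodeDeriv_succ (v : Vec d) (i : Fin d) : nodeDeriv d (i + 1) v = v i := by
  simp [nodeDeriv]

@[simp] theorem nodeDeriv_last (v : Vec d) : nodeDeriv d (d + 1) v = 0 := by simp [nodeDeriv]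

theorem node_sub (x y : Vec d) (n : ℕ) : node x n - node y n = nodeDeriv d n (x - y) := by
  cases n with
  | zero => simp
  | succ n => by_cases h : n < d <;> simp [node, nodeDeriv, h]

theorem hasFDerivAt_node (x : Vec d) (n : ℕ) :
    HasFDerivAt (fun x : Vec d => node x n) (nodeDeriv d n) x := by
  cases n with
  | zero => exact hasFDerivAt_const _ _
  | succ n =>
    by_cases h : n < d
    · simp only [node, nodeDeriv, h, dif_pos]
      exact (EuclideanSpace.proj (𝕜 := ℝ) (⟨n, h⟩ : Fin d)).hasFDerivAt
    · simp only [node, nodeDeriv, h, dif_neg, not_false_eq_true]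
      exact hasFDerivAt_const _ _

theorem contDiff_node (n : ℕ) : ContDiff ℝ 1 (fun x : Vec d => node x n) := by
  cases n with
  | zero => exact contDiff_const
  | succ n =>
    by_cases h : n < d
    · simp only [node, h, dif_pos]
      exact (EuclideanSpace.proj (𝕜 := ℝ) (⟨n, h⟩ : Fin d)).contDiff
    · simp only [node, h, dif_neg, not_false_eq_true]
      exact contDiff_const

/-- The zero-chain: a sum of terms that couple consecutive coordinates. -/
def chain (d : ℕ) (x : Vec d) : ℝ :=
  ∑ n ∈ Finset.range (d + 1),
    (sqRamp (-node x (n + 1)) - smoothStep (node x n) * wideStep (node x (n + 1)))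

/-- The gradient of `chain`. -/
def chainGrad (x : Vec d) : Vec d :=
  WithLp.toLp 2 fun i => min (x i) 0 - smoothStep (node x i) * trapezoid (x i) -
    tent (x i) * wideStep (node x (i + 2))

theorem chainGrad_apply (x : Vec d) (i : Fin d) : chainGrad x i =
    min (x i) 0 - smoothStep (node x i) * trapezoid (x i) -
      tent (x i) * wideStep (node x (i + 2)) := rfl

theorem contDiff_chain : ContDiff ℝ 1 (chain d) := by
  refine ContDiff.sum fun n _ => ?_
  exact (contDiff_sqRamp.comp (contDiff_node (n + 1)).neg).sub
    ((contDiff_smoothStep.comp (contDiff_node n)).mul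
      (contDiff_wideStep.comp (contDiff_node (n + 1))))

theorem hasGradientAt_chain (x : Vec d) : HasGradientAt (chain d) (chainGrad x) x := by
  rw [hasGradientAt_iff_hasFDerivAt]
  have h := HasFDerivAt.fun_sum (u := Finset.range (d + 1)) fun n _ =>
    ((hasDerivAt_sqRamp (-node x (n + 1))).comp_hasFDerivAt x
      (hasFDerivAt_node x (n + 1)).neg).sub
    (((hasDerivAt_smoothStep (node x n)).comp_hasFDerivAt x (hasFDerivAt_node x n)).mul
      ((hasDerivAt_wideStep (node x (n + 1))).comp_hasFDerivAt x (hasFDerivAt_node x (n + 1))))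
  refine h.congr_fderiv ?_
  ext v
  have hmin : ∀ t : ℝ, max (-t) 0 = -min t 0 := fun t => by grind
  simp only [sum_apply, sub_apply,
    add_apply, smul_apply, neg_apply,
    smul_eq_mul, InnerProductSpace.toDual_apply_apply, PiLp.inner_apply, Function.comp_apply, hmin]
  have e : ∀ n, -min (node x (n + 1)) 0 * -nodeDeriv d (n + 1) v -
      (smoothStep (node x n) * (trapezoid (node x (n + 1)) * nodeDeriv d (n + 1) v) +
        wideStep (node x (n + 1)) * (tent (node x n) * nodeDeriv d n v)) =
      (min (node x (n + 1)) 0 - smoothStep (node x n) * trapezoid (node x (n + 1))) *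
        nodeDeriv d (n + 1) v -
      tent (node x n) * wideStep (node x (n + 1)) * nodeDeriv d n v := fun n => by ring
  simp only [e, Finset.sum_sub_distrib]
  -- Each summand involves nodes `n` and `n + 1`; an index shift collects both contributions at one
  -- coordinate. The end nodes `0` and `d + 1` are constant and drop out.
  rw [Finset.sum_range_succ, Finset.sum_range_succ' (fun n => tent (node x n) * _ * _),
    nodeDeriv_last, nodeDeriv_zero, mul_zero, mul_zero, add_zero, add_zero,
    ← Finset.sum_sub_distrib, Finset.sum_range]
  refine Finset.sum_congr rfl fun i _ => ?_
  simp only [node_succ, nodeDeriv_succ, chainGrad_apply, RCLike.inner_apply, conj_trivial]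
  ring

theorem neg_le_chain (x : Vec d) : -(4 * ((d : ℝ) + 1)) ≤ chain d x := by
  have h : ∀ n ∈ Finset.range (d + 1), (-4 : ℝ) ≤
      sqRamp (-node x (n + 1)) - smoothStep (node x n) * wideStep (node x (n + 1)) := by
    intro n _
    have h1 := mul_le_mul (smoothStep_le_one (node x n)) (wideStep_le_four (node x (n + 1)))
      (wideStep_nonneg _) zero_le_one
    linarith [sqRamp_nonneg (-node x (n + 1))]
  have := Finset.card_nsmul_le_sum _ _ _ h
  simp only [Finset.card_range, nsmul_eq_mul, Nat.cast_add, Nat.cast_one] at this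
  unfold chain
  linarith

theorem chain_zero_nonpos : chain d 0 ≤ 0 := by
  refine Finset.sum_nonpos fun n _ => ?_
  have h0 : node (0 : Vec d) (n + 1) = 0 := by simp [node]
  have := mul_nonneg (smoothStep_nonneg (node (0 : Vec d) n)) (wideStep_nonneg 0)
  rw [h0, sqRamp_of_nonpos (by simp)]
  linarith

theorem sum_nodeDeriv_succ_sq (v : Vec d) :
    ∑ i ∈ Finset.range d, nodeDeriv d (i + 1) v ^ 2 = ‖v‖ ^ 2 := by
  rw [Finset.sum_range, EuclideanSpace.norm_sq_eq]
  simp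

/-- Only neighbouring nodes interact, so the constant is free of `d`. The weight `6 = 1 + 1 + 4`
comes from the ramp, the trapezoid, and the tent times `wideStep ≤ 4`; Cauchy–Schwarz and summation
give `8 * (1 + 6 + 1) = 8 ^ 2`. -/
theorem norm_chainGrad_sub_le (x y : Vec d) : ‖chainGrad x - chainGrad y‖ ≤ 8 * ‖x - y‖ := by
  refine le_of_sq_le_sq ?_ (by positivity)
  set D : ℕ → ℝ := fun n => nodeDeriv d n (x - y)
  have hcoord : ∀ i : Fin d, ‖(chainGrad x - chainGrad y) i‖ ^ 2 ≤
      8 * (D i ^ 2 + 6 * D (i + 1) ^ 2 + D (i + 2) ^ 2) := by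
    intro i
    have h0 : |node x i - node y i| = |D i| := by rw [node_sub]
    have h1 : |x i - y i| = |D (i + 1)| := by rw [← node_succ x, ← node_succ y, node_sub]
    have h2 : |node x (i + 2) - node y (i + 2)| = |D (i + 2)| := by rw [node_sub]
    have b1 := abs_mul_sub_mul_le (smoothStep (node x i)) (trapezoid (x i))
      (smoothStep (node y i)) (trapezoid (y i))
    have b2 := abs_mul_sub_mul_le (tent (x i)) (wideStep (node x (i + 2)))
      (tent (y i)) (wideStep (node y (i + 2)))
    have c1 := abs_smoothStep_sub_le (node x i) (node y i)
    have c2 := abs_trapezoid_sub_le (x i) (y i)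
    have c3 := abs_tent_sub_le (x i) (y i)
    have c4 := abs_wideStep_sub_le (node x (i + 2)) (node y (i + 2))
    have c5 : |min (x i) 0 - min (y i) 0| ≤ |x i - y i| := by grind
    rw [abs_of_nonneg (trapezoid_nonneg _), abs_of_nonneg (smoothStep_nonneg (node y i))] at b1
    rw [abs_of_nonneg (tent_nonneg _), abs_of_nonneg (wideStep_nonneg _)] at b2
    rw [h0] at c1
    rw [h1] at c2 c3 c5
    rw [h2] at c4
    have m1 := mul_le_mul c1 (trapezoid_le_one (x i)) (trapezoid_nonneg _) (abs_nonneg _)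
    have m2 := mul_le_mul (smoothStep_le_one (node y i)) c2 (abs_nonneg _) zero_le_one
    have m3 := mul_le_mul c3 (wideStep_le_four (node x (i + 2))) (wideStep_nonneg _)
      (abs_nonneg _)
    have m4 := mul_le_mul (tent_le_one (y i)) c4 (abs_nonneg _) zero_le_one
    have hle : ‖(chainGrad x - chainGrad y) i‖ ≤ |D i| + 6 * |D (i + 1)| + |D (i + 2)| := by
      rw [PiLp.sub_apply, chainGrad_apply, chainGrad_apply, Real.norm_eq_abs]
      have t : ∀ a b c a' b' c' : ℝ,
          |a - b - c - (a' - b' - c')| ≤ |a - a'| + |b - b'| + |c - c'| := by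
        intro a b c a' b' c'; grind
      refine (t _ _ _ _ _ _).trans ?_
      linarith
    rw [← sq_abs (D i), ← sq_abs (D (i + 1)), ← sq_abs (D (i + 2))]
    have := pow_le_pow_left₀ (norm_nonneg _) hle 2
    nlinarith [sq_nonneg (|D i| - |D (i + 1)|), sq_nonneg (|D i| - |D (i + 2)|),
      sq_nonneg (|D (i + 1)| - |D (i + 2)|)]
  have s1 : ∑ i ∈ Finset.range d, D (i + 1) ^ 2 = ‖x - y‖ ^ 2 := sum_nodeDeriv_succ_sq _
  have s0 : ∑ i ∈ Finset.range d, D i ^ 2 ≤ ‖x - y‖ ^ 2 := by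
    rw [← s1]
    have e := Finset.sum_range_succ (fun i => D i ^ 2) d
    rw [Finset.sum_range_succ'] at e
    have : D 0 = 0 := nodeDeriv_zero _
    nlinarith [sq_nonneg (D d)]
  have s2 : ∑ i ∈ Finset.range d, D (i + 2) ^ 2 ≤ ‖x - y‖ ^ 2 := by
    rw [← s1]
    have e := Finset.sum_range_succ (fun i => D (i + 1) ^ 2) d
    rw [Finset.sum_range_succ'] at e
    have : D (d + 1) = 0 := nodeDeriv_last _
    have h0 := sq_nonneg (D (0 + 1))
    rw [this] at e
    simp only [add_assoc, one_add_one_eq_two] at e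
    linarith
  rw [EuclideanSpace.norm_sq_eq]
  refine (Finset.sum_le_sum fun i _ => hcoord i).trans ?_
  rw [← Finset.sum_range (fun i => 8 * (D i ^ 2 + 6 * D (i + 1) ^ 2 + D (i + 2) ^ 2)),
    ← Finset.mul_sum, Finset.sum_add_distrib, Finset.sum_add_distrib, ← Finset.mul_sum, s1]
  nlinarith

/-- Node `0` has value `3` and the last coordinate is `0`, so some node of value at least `3` is
followed by a coordinate at most `3`. There `smoothStep` is saturated, and the remaining coupling
term has the favourable sign. -/
theorem one_le_norm_chainGrad {x : Vec d} (hd : 1 ≤ d) (hx : ∀ c, x c ≠ 0 → c.val + 1 < d) :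
    1 ≤ ‖chainGrad x‖ := by
  obtain ⟨i, h3, hi⟩ : ∃ i : Fin d, 3 ≤ node x i ∧ x i ≤ 3 := by
    by_contra! hcon
    have hall : ∀ n ≤ d, 3 ≤ node x n := by
      intro n
      induction n with
      | zero => simp
      | succ n ih =>
        intro hn
        have := hcon ⟨n, hn⟩ (ih (by omega))
        rw [← node_succ x ⟨n, hn⟩] at this
        exact this.le
    obtain ⟨m, rfl⟩ : ∃ m, d = m + 1 := ⟨d - 1, by omega⟩
    have h1 : 3 ≤ node x ((Fin.last m : ℕ) + 1) := hall (m + 1) le_rfl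
    rw [node_succ] at h1
    have := hx (Fin.last m) (by linarith)
    simp at this
  have h1 : 1 ≤ -chainGrad x i := by
    rw [chainGrad_apply, smoothStep_of_three_le h3]
    have := one_le_trapezoid_sub_min hi
    have := mul_nonneg (tent_nonneg (x i)) (wideStep_nonneg (node x (i + 2)))
    linarith
  exact (h1.trans (neg_le_abs _)).trans (PiLp.norm_apply_le (chainGrad x) i)

/-! ### The noise field -/

/-- The vector obtained from `x` by deleting the coordinates before `i`. -/
def tail (x : Vec d) (i : Fin d) : Vec d := WithLp.toLp 2 fun j => if i ≤ j then x j else 0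

theorem tail_apply (x : Vec d) (i j : Fin d) : tail x i j = if i ≤ j then x j else 0 := rfl

theorem tail_sub (x y : Vec d) (i : Fin d) : tail x i - tail y i = tail (x - y) i := by
  ext j
  by_cases h : i ≤ j <;> simp [tail_apply, h]

theorem norm_tail_le (x : Vec d) (i : Fin d) : ‖tail x i‖ ≤ ‖x‖ := by
  refine le_of_sq_le_sq ?_ (norm_nonneg _)
  rw [EuclideanSpace.norm_sq_eq, EuclideanSpace.norm_sq_eq]
  refine Finset.sum_le_sum fun j _ => ?_
  by_cases h : i ≤ j <;> simp [tail_apply, h, sq_nonneg]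

/-- A bounded Lipschitz vector field that agrees with `chainGrad` in the first coordinate that is
not yet discovered and has at most one nonzero coordinate. -/
def chainNoise (x : Vec d) : Vec d :=
  WithLp.toLp 2 fun i => -(smoothStep (node x i) * max 0 (1 - ‖tail x i‖))

theorem chainNoise_apply (x : Vec d) (i : Fin d) :
    chainNoise x i = -(smoothStep (node x i) * max 0 (1 - ‖tail x i‖)) := rfl

theorem cutoff_le_one (x : Vec d) (i : Fin d) : max 0 (1 - ‖tail x i‖) ≤ 1 :=
  max_le zero_le_one (by linarith [norm_nonneg (tail x i)])

/-- Noise at `j > i` needs the preceding coordinate to exceed `1`; that coordinate belongs to the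
tail from `i`, whose norm then closes the cutoff at `i`. -/
theorem chainNoise_unique {x : Vec d} {i j : Fin d} (hi : chainNoise x i ≠ 0)
    (hj : chainNoise x j ≠ 0) : i = j := by
  have key : ∀ i j : Fin d, i < j → chainNoise x i ≠ 0 → chainNoise x j ≠ 0 → False := by
    intro i j hij hi hj
    have h1 : 1 < node x j := by
      by_contra! h
      exact hj (by rw [chainNoise_apply, smoothStep_of_le_one h]; ring)
    have hij' : i.val < j.val := hij
    have hjd := j.2
    have hj1 : j.val = (⟨j.val - 1, by omega⟩ : Fin d).val + 1 := by simp; omega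
    rw [hj1, node_succ] at h1
    have h2 := PiLp.norm_apply_le (tail x i) ⟨j.val - 1, by omega⟩
    rw [tail_apply, if_pos (Fin.le_def.2 (by simp; omega)), Real.norm_eq_abs] at h2
    have h3 : 1 ≤ ‖tail x i‖ := by linarith [le_abs_self (x ⟨j.val - 1, by omega⟩)]
    exact hi (by rw [chainNoise_apply, max_eq_left (by linarith)]; ring)
  rcases lt_trichotomy i j with h | h | h
  · exact (key i j h hi hj).elim
  · exact h
  · exact (key j i h hj hi).elim

theorem exists_chainNoise_support (x : Vec d) (i₀ : Fin d) :
    ∃ a : Fin d, ∀ i, i ≠ a → chainNoise x i = 0 := by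
  by_cases h : ∃ a, chainNoise x a ≠ 0
  · obtain ⟨a, ha⟩ := h
    exact ⟨a, fun i hi => by by_contra hc; exact hi (chainNoise_unique hc ha)⟩
  · push Not at h
    exact ⟨i₀, fun i _ => h i⟩

theorem norm_chainNoise_le (hd : 1 ≤ d) (x : Vec d) : ‖chainNoise x‖ ≤ 1 := by
  obtain ⟨a, ha⟩ := exists_chainNoise_support x ⟨0, hd⟩
  refine le_of_sq_le_sq ?_ zero_le_one
  rw [EuclideanSpace.norm_sq_eq, Finset.sum_eq_single a (fun i _ hi => by simp [ha i hi])
    (by simp)]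
  refine pow_le_pow_left₀ (norm_nonneg _) ?_ 2
  rw [chainNoise_apply, norm_neg, Real.norm_of_nonneg
    (mul_nonneg (smoothStep_nonneg _) (le_max_left _ _))]
  exact mul_le_one₀ (smoothStep_le_one _) (le_max_left _ _) (cutoff_le_one x a)

/-- Each coordinate changes by at most `2 * ‖x - y‖`, and at most two coordinates are involved, one
from each point; `2 * √2 ≤ 3`. -/
theorem norm_chainNoise_sub_le (hd : 1 ≤ d) (x y : Vec d) :
    ‖chainNoise x - chainNoise y‖ ≤ 3 * ‖x - y‖ := by
  have hcoord : ∀ i, ‖(chainNoise x - chainNoise y) i‖ ≤ 2 * ‖x - y‖ := by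
    intro i
    have h1 : |node x i - node y i| ≤ ‖x - y‖ := by
      rcases Nat.eq_zero_or_pos i.val with h | h
      · simp [h]
      · have hi := i.2
        have hi1 : i.val = (⟨i.val - 1, by omega⟩ : Fin d).val + 1 := by simp; omega
        rw [hi1, node_succ, node_succ]
        exact PiLp.norm_apply_le (x - y) _
    have h2 : |max 0 (1 - ‖tail x i‖) - max 0 (1 - ‖tail y i‖)| ≤ ‖x - y‖ := by
      have h3 := (abs_norm_sub_norm_le (tail x i) (tail y i)).trans
        ((tail_sub x y i ▸ norm_tail_le (x - y) i))
      have h4 : ∀ a b : ℝ, |max 0 (1 - a) - max 0 (1 - b)| ≤ |a - b| := fun a b => by grind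
      exact (h4 _ _).trans h3
    have h3 := abs_mul_sub_mul_le (smoothStep (node x i)) (max 0 (1 - ‖tail x i‖))
      (smoothStep (node y i)) (max 0 (1 - ‖tail y i‖))
    rw [abs_of_nonneg (le_max_left 0 (1 - ‖tail x i‖)),
      abs_of_nonneg (smoothStep_nonneg (node y i))] at h3
    have h4 := mul_le_mul ((abs_smoothStep_sub_le _ _).trans h1) (cutoff_le_one x i)
      (le_max_left _ _) (norm_nonneg _)
    have h5 := mul_le_mul (smoothStep_le_one (node y i)) h2 (abs_nonneg _) zero_le_one
    rw [PiLp.sub_apply, chainNoise_apply, chainNoise_apply, neg_sub_neg, Real.norm_eq_abs,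
      abs_sub_comm]
    linarith
  obtain ⟨a, ha⟩ := exists_chainNoise_support x ⟨0, hd⟩
  obtain ⟨b, hb⟩ := exists_chainNoise_support y ⟨0, hd⟩
  refine le_of_sq_le_sq ?_ (by positivity)
  rw [EuclideanSpace.norm_sq_eq]
  have hle : ∀ i ∈ Finset.univ, ‖(chainNoise x - chainNoise y) i‖ ^ 2 ≤
      (if i = a then (2 * ‖x - y‖) ^ 2 else 0) + (if i = b then (2 * ‖x - y‖) ^ 2 else 0) := by
    intro i _
    have h1 := pow_le_pow_left₀ (norm_nonneg _) (hcoord i) 2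
    have h2 := sq_nonneg (2 * ‖x - y‖)
    by_cases hia : i = a
    · rw [if_pos hia]
      split_ifs <;> linarith
    · by_cases hib : i = b
      · rw [if_pos hib, if_neg hia]
        linarith
      · simp [PiLp.sub_apply, ha i hia, hb i hib, hia, hib]
  refine (Finset.sum_le_sum hle).trans ?_
  rw [Finset.sum_add_distrib, Finset.sum_ite_eq', Finset.sum_ite_eq']
  simp only [Finset.mem_univ, if_true]
  nlinarith [sq_nonneg ‖x - y‖]

theorem node_eq_zero {x : Vec d} {m : ℕ} (hx : ∀ c, x c ≠ 0 → c.val < m) {n : ℕ} (hn : m < n) :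
    node x n = 0 := by
  obtain ⟨n, rfl⟩ : ∃ k, n = k + 1 := ⟨n - 1, by omega⟩
  by_cases h : n < d
  · simp only [node, h, dif_pos]
    by_contra hc
    have := hx _ hc
    simp at this
    omega
  · simp [node, h]

theorem chainGrad_apply_undiscovered {x : Vec d} {m : ℕ} (hx : ∀ c, x c ≠ 0 → c.val < m)
    {i : Fin d} (hi : m ≤ i.val) : chainGrad x i = -smoothStep (node x i) := by
  have h0 : x i = 0 := by rw [← node_succ]; exact node_eq_zero hx (by omega)
  rw [chainGrad_apply, h0, tent_zero, trapezoid_zero]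
  simp

theorem chainNoise_apply_undiscovered {x : Vec d} {m : ℕ} (hx : ∀ c, x c ≠ 0 → c.val < m)
    {i : Fin d} (hi : m ≤ i.val) : chainNoise x i = -smoothStep (node x i) := by
  have h0 : tail x i = 0 := by
    ext j
    rw [tail_apply]
    split_ifs with hij
    · by_contra hc
      have := hx j hc
      have : i.val ≤ j.val := hij
      omega
    · rfl
  rw [chainNoise_apply, h0]
  simp

end Chain

/-! ### Scaling and the three hard instances -/

section HardInstance

/-- The chain, rescaled to have gradient `2 * ε • chainGrad (ρ⁻¹ • x)`. -/
def scaledChain (d : ℕ) (ε ρ : ℝ) (x : Vec d) : ℝ := 2 * ε * ρ * chain d (ρ⁻¹ • x)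

theorem gradient_scaledChain {d : ℕ} (ε : ℝ) {ρ : ℝ} (hρ : ρ ≠ 0) (x : Vec d) :
    gradient (scaledChain d ε ρ) x = (2 * ε) • chainGrad (ρ⁻¹ • x) := by
  refine HasGradientAt.gradient ?_
  rw [hasGradientAt_iff_hasFDerivAt]
  have h1 := (hasGradientAt_iff_hasFDerivAt.1 (hasGradientAt_chain (ρ⁻¹ • x))).comp x
    ((hasFDerivAt_id x).const_smul ρ⁻¹)
  refine (h1.const_mul (2 * ε * ρ)).congr_fderiv ?_
  ext v
  simp only [smul_apply, ContinuousLinearMap.comp_apply, ContinuousLinearMap.id_apply,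
    InnerProductSpace.toDual_apply_apply, inner_smul_left, inner_smul_right, smul_eq_mul,
    conj_trivial]
  field_simp

theorem contDiff_scaledChain (d : ℕ) (ε ρ : ℝ) : ContDiff ℝ 1 (scaledChain d ε ρ) :=
  contDiff_const.mul (contDiff_chain.comp (contDiff_id.const_smul ρ⁻¹))

theorem scaledChain_mem_functionClass {d : ℕ} (hd : 1 ≤ d) {ε ρ Δ L : ℝ} (hε : 0 < ε)
    (hρ : 0 < ρ) (hL : 16 * ε ≤ L * ρ) (hΔ : 16 * ε * ρ * d ≤ Δ) :
    scaledChain d ε ρ ∈ FunctionClass d Δ L := by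
  have hd' : (1 : ℝ) ≤ d := by exact_mod_cast hd
  have hlow : ∀ x, -Δ ≤ scaledChain d ε ρ x := by
    intro x
    have h1 := mul_le_mul_of_nonneg_left (neg_le_chain (ρ⁻¹ • x))
      (show 0 ≤ 2 * ε * ρ by positivity)
    have h2 : 8 * (ε * ρ) * ((d : ℝ) + 1) ≤ 8 * (ε * ρ) * (2 * d) := by gcongr; linarith
    unfold scaledChain
    linarith
  refine ⟨contDiff_scaledChain d ε ρ, ⟨-Δ, by rintro _ ⟨x, rfl⟩; exact hlow x⟩, ?_, ?_⟩
  · have h0 : scaledChain d ε ρ 0 ≤ 0 := by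
      unfold scaledChain
      rw [smul_zero]
      exact mul_nonpos_of_nonneg_of_nonpos (by positivity) chain_zero_nonpos
    linarith [le_ciInf hlow]
  · intro x y
    rw [gradient_scaledChain ε hρ.ne', gradient_scaledChain ε hρ.ne', ← smul_sub, norm_smul,
      Real.norm_of_nonneg (by positivity)]
    have h1 := norm_chainGrad_sub_le (ρ⁻¹ • x) (ρ⁻¹ • y)
    rw [← smul_sub, norm_smul, Real.norm_of_nonneg (by positivity)] at h1
    have h2 : 16 * ε * ρ⁻¹ ≤ L := by
      rw [← div_eq_mul_inv, div_le_iff₀ hρ]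
      exact hL
    calc _ ≤ 2 * ε * (8 * (ρ⁻¹ * ‖x - y‖)) := by gcongr
      _ = 16 * ε * ρ⁻¹ * ‖x - y‖ := by ring
      _ ≤ _ := by gcongr

/-- There is an admissible function and oracle against which every zero-respecting algorithm needs
at least `X` rounds. -/
def HardInstance (K : ℕ) (p q ε L₁ Δ δ σ₁ X : ℝ) : Prop :=
  ∃ d : ℕ, 1 ≤ d ∧ ∃ F ∈ FunctionClass d Δ L₁, ∃ O ∈ OracleClass F p σ₁ q δ,
    ∀ A ∈ ZeroRespectingClass.{u} d K, ENNReal.ofReal X ≤ A.complexity O ε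

variable {K : ℕ} {p q ε L₁ Δ δ σ₁ X Y : ℝ}

theorem HardInstance.mono (h : HardInstance.{u} K p q ε L₁ Δ δ σ₁ X) (hYX : Y ≤ X) :
    HardInstance.{u} K p q ε L₁ Δ δ σ₁ Y := by
  obtain ⟨d, hd, F, hF, O, hO, hA⟩ := h
  exact ⟨d, hd, F, hF, O, hO, fun A h => (ENNReal.ofReal_le_ofReal hYX).trans (hA A h)⟩

/-- The scale `ρ = 16 * ε / L` gives the gradient Lipschitz constant `L` and the noise size `2 * ε *
c` and Lipschitz constant `ℓ * L / 8`. Taking `L` below `L₁` shortens the chain but eases the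
similarity condition. -/
theorem hardInstance_of_noise {d : ℕ} (hd : 1 ≤ d) {L θ τ c ℓ : ℝ} (hε : 0 < ε) (hL : 0 < L)
    (hLL : L ≤ L₁) (hΔ : 256 * ε ^ 2 * d ≤ L * Δ) (h0 : 0 < θ) (h1 : θ ≤ 1) (hp : 1 ≤ p)
    (hq : 1 ≤ q) (hℓ : 0 ≤ ℓ) {N : Vec d → Vec d} (hbd : ∀ x, ‖N x‖ ≤ c)
    (hlip : ∀ x y, ‖N x - N y‖ ≤ ℓ * ‖x - y‖)
    (hσ : 2 * (2 * ε * c) ^ p * θ ^ (1 - p) ≤ σ₁ ^ p)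
    (hδ : 2 * (ℓ * L / 8) ^ q * θ ^ (1 - q) ≤ δ ^ q)
    (w : Bool → ℕ) (hτ : 0 < τ)
    (hmean : ∫⁻ b, (w b : ℝ≥0∞) ∂(bernoulliLaw θ) ≤ ENNReal.ofReal τ)
    (hstep : ∀ (z : Vec d) b m, (∀ c, z c ≠ 0 → c.val < m) →
      ∀ c, (chainGrad z + noiseFactor θ b • N z) c ≠ 0 → c.val < m + w b) :
    HardInstance.{u} K p q ε L₁ Δ δ σ₁ (d / (2 * τ)) := by
  set ρ : ℝ := 16 * ε / L with hρdef
  have hρ : 0 < ρ := by positivity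
  have hLρ : L * ρ = 16 * ε := by rw [hρdef]; field_simp
  have hmem : scaledChain d ε ρ ∈ FunctionClass d Δ L₁ := by
    refine scaledChain_mem_functionClass hd hε hρ ?_ ?_
    · rw [← hLρ]; gcongr
    · rw [hρdef, show 16 * ε * (16 * ε / L) * d = 256 * ε ^ 2 * d / L by ring,
        div_le_iff₀ hL]
      linarith
  have hgrad : gradient (scaledChain d ε ρ) = fun x => (2 * ε) • chainGrad (ρ⁻¹ • x) :=
    funext (gradient_scaledChain ε hρ.ne')
  have hcont : ∀ {E : Vec d → Vec d} {C : ℝ}, (∀ x y, ‖E x - E y‖ ≤ C * ‖x - y‖) →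
      Continuous fun x => (2 * ε) • E (ρ⁻¹ • x) := fun {E C} h => by
    have : Continuous E := (LipschitzWith.of_dist_le_mul (K := C.toNNReal) fun x y => by
      rw [dist_eq_norm, dist_eq_norm]
      exact (h x y).trans (by gcongr; exact Real.le_coe_toNNReal C)).continuous
    fun_prop
  have hFc : Continuous (gradient (scaledChain d ε ρ)) := by
    rw [hgrad]
    exact hcont norm_chainGrad_sub_le
  have hNc := hcont hlip
  refine ⟨d, hd, _, hmem, bernoulliOracle hFc hNc h0 h1,
    bernoulliOracle_mem_oracleClass hFc hNc h0 h1 (c := 2 * ε * c) (ℓ := ℓ * L / 8) hp hq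
      (by positivity) ?_ ?_ hσ hδ, fun A hA => ?_⟩
  · intro x
    rw [norm_smul, Real.norm_of_nonneg (by positivity)]
    gcongr
    exact hbd _
  · intro x y
    rw [← smul_sub, norm_smul, Real.norm_of_nonneg (by positivity)]
    have h2 := hlip (ρ⁻¹ • x) (ρ⁻¹ • y)
    rw [← smul_sub, norm_smul, Real.norm_of_nonneg (by positivity)] at h2
    calc _ ≤ 2 * ε * (ℓ * (ρ⁻¹ * ‖x - y‖)) := by gcongr
      _ = ℓ * L / 8 * ‖x - y‖ := by rw [hρdef]; field_simp; ring
  · have hw : Measurable w := .of_discrete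
    refine RandomizedAlgorithm.le_complexity_of_progress (contDiff_scaledChain d ε ρ)
      (bernoulliOracle hFc hNc h0 h1) (w := w) hw hτ hε hmean ?_ ?_ hA
    · intro x b m hx i hi
      refine hstep (ρ⁻¹ • x) b m (fun j hj => hx j fun h => hj (by simp [h])) i fun h => hi ?_
      change (gradient (scaledChain d ε ρ) x + noiseFactor θ b • (2 * ε) • N (ρ⁻¹ • x)) i = 0
      rw [hgrad, smul_comm, ← smul_add, PiLp.smul_apply, h, smul_zero]
    · intro x hx
      rw [hgrad, norm_smul, Real.norm_of_nonneg (by positivity)]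
      have := one_le_norm_chainGrad (x := ρ⁻¹ • x) hd
        (fun j hj => hx j fun h => hj (by simp [h]))
      nlinarith

/-- For `false` the factor `-1` cancels the gradient in every undiscovered coordinate. For `true`
only coordinate `m` can appear, because all later ones follow a zero node. -/
theorem chainNoise_step {d : ℕ} {θ : ℝ} (z : Vec d) (b : Bool) (m : ℕ)
    (hz : ∀ c, z c ≠ 0 → c.val < m) (c : Fin d)
    (hc : (chainGrad z + noiseFactor θ b • chainNoise z) c ≠ 0) : c.val < m + b.toNat := by
  by_contra! hle
  apply hc
  rw [PiLp.add_apply, PiLp.smul_apply, chainGrad_apply_undiscovered hz (by omega),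
    chainNoise_apply_undiscovered hz (by omega)]
  cases b
  · simp [noiseFactor]
  · rw [node_eq_zero hz (by simpa using hle), smoothStep_of_le_one zero_le_one]
    simp

theorem lintegral_toNat_bernoulliLaw (θ : ℝ) :
    ∫⁻ b, (b.toNat : ℝ≥0∞) ∂(bernoulliLaw θ) = ENNReal.ofReal θ := by
  simp [lintegral_bernoulliLaw]

theorem exists_chain_length {L : ℝ} (hε : 0 < ε) (h : 256 ≤ L * Δ / ε ^ 2) :
    ∃ d : ℕ, 1 ≤ d ∧ 256 * ε ^ 2 * d ≤ L * Δ ∧ L * Δ / ε ^ 2 / 512 ≤ d := by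
  have h1 : 1 ≤ ⌊L * Δ / ε ^ 2 / 256⌋₊ := Nat.one_le_floor_iff _ |>.2 (by linarith)
  refine ⟨⌊L * Δ / ε ^ 2 / 256⌋₊, h1, ?_, ?_⟩
  · have h2 := Nat.floor_le (show 0 ≤ L * Δ / ε ^ 2 / 256 by linarith)
    calc _ ≤ 256 * ε ^ 2 * (L * Δ / ε ^ 2 / 256) := by gcongr
      _ = L * Δ := by field_simp
  · have h2 := Nat.lt_floor_add_one (L * Δ / ε ^ 2 / 256)
    have h3 : (1 : ℝ) ≤ (⌊L * Δ / ε ^ 2 / 256⌋₊ : ℝ) := by exact_mod_cast h1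
    linarith

theorem hardInstance_noiseless (hp : 1 ≤ p) (hq : 1 ≤ q) (hε : 0 < ε) (hL : 0 < L₁)
    (hδ : 0 ≤ δ) (hσ : 0 ≤ σ₁) (h : 256 ≤ L₁ * Δ / ε ^ 2) :
    HardInstance.{u} K p q ε L₁ Δ δ σ₁ (L₁ * Δ / ε ^ 2 / 1024) := by
  obtain ⟨d, hd, hd1, hd2⟩ := exists_chain_length hε h
  have hp0 : p ≠ 0 := by linarith
  have hq0 : q ≠ 0 := by linarith
  refine (hardInstance_of_noise hd (θ := 1) (τ := 1) (c := 0) (ℓ := 0) (N := fun _ => 0) hε hL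
    le_rfl hd1 one_pos le_rfl hp hq le_rfl (by simp) (by simp) ?_ ?_ (fun _ => 1) one_pos ?_
    ?_).mono (by linarith)
  · simpa [hp0] using Real.rpow_nonneg hσ p
  · simpa [hq0] using Real.rpow_nonneg hδ q
  · rw [lintegral_bernoulliLaw]
    simp
  · intro z b m hz c hc
    by_contra! hle
    apply hc
    rw [smul_zero, add_zero, chainGrad_apply_undiscovered hz (by omega),
      node_eq_zero hz (by omega), smoothStep_of_le_one zero_le_one, neg_zero]

/-- In dimension one only the answer at the origin has to be hidden. A constant noise field does
this and has similarity constant `0`, so `δ` imposes nothing. -/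
theorem hardInstance_single {θ : ℝ} (hp : 1 ≤ p) (hq : 1 ≤ q) (hε : 0 < ε) (hL : 0 < L₁)
    (hδ : 0 ≤ δ) (h0 : 0 < θ) (h1 : θ ≤ 1) (hσ : 2 * (2 * ε) ^ p * θ ^ (1 - p) ≤ σ₁ ^ p)
    (h : 256 ≤ L₁ * Δ / ε ^ 2) :
    HardInstance.{u} K p q ε L₁ Δ δ σ₁ (1 / (2 * θ)) := by
  have hq0 : q ≠ 0 := by linarith
  have hΔ : 256 * ε ^ 2 * (1 : ℕ) ≤ L₁ * Δ := by
    rw [le_div_iff₀ (by positivity)] at h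
    simpa using h
  have := hardInstance_of_noise.{u} (K := K) (d := 1) (σ₁ := σ₁) (δ := δ) (p := p) (q := q) le_rfl
    (c := 1) (ℓ := 0) (N := fun _ => chainNoise 0) hε hL le_rfl hΔ h0 h1 hp hq le_rfl
    (fun _ => norm_chainNoise_le le_rfl 0) (by simp) (by simpa using hσ)
    (by simpa [hq0] using Real.rpow_nonneg hδ q) (fun b => b.toNat) h0
    (lintegral_toNat_bernoulliLaw θ).le ?_
  · simpa using this
  · intro z b m hz c hc
    rcases Nat.eq_zero_or_pos m with rfl | hm
    · have hz0 : z = 0 := by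
        ext j
        by_contra hj
        exact absurd (hz j hj) (by omega)
      subst hz0
      exact chainNoise_step 0 b 0 hz c hc
    · omega

theorem hardInstance_chain {θ L : ℝ} (hp : 1 ≤ p) (hq : 1 ≤ q) (hε : 0 < ε) (hL : 0 < L)
    (hLL : L ≤ L₁) (h0 : 0 < θ) (h1 : θ ≤ 1)
    (hσ : 2 * (2 * ε) ^ p * θ ^ (1 - p) ≤ σ₁ ^ p) (hδ : L ^ q * θ ^ (1 - q) ≤ δ ^ q)
    (h : 256 ≤ L * Δ / ε ^ 2) :
    HardInstance.{u} K p q ε L₁ Δ δ σ₁ (L * Δ / ε ^ 2 / (1024 * θ)) := by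
  obtain ⟨d, hd, hd1, hd2⟩ := exists_chain_length hε h
  refine (hardInstance_of_noise hd (c := 1) (ℓ := 3) (N := chainNoise) hε hL
    hLL hd1 h0 h1 hp hq (by norm_num) (norm_chainNoise_le hd) (norm_chainNoise_sub_le hd)
    (by simpa using hσ) ?_ (fun b => b.toNat) h0 (lintegral_toNat_bernoulliLaw θ).le
    (fun z b m => chainNoise_step z b m)).mono ?_
  · refine le_trans ?_ hδ
    gcongr
    -- Since `3 / 8 ≤ 1 / 2` and `(1 / 2) ^ q ≤ 1 / 2`, the factor `2` of the moment bound is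
    -- absorbed.
    have h2 : (3 * L / 8) ^ q ≤ (L * (1 / 2)) ^ q := by gcongr; linarith
    have h3 : (1 / 2 : ℝ) ^ q ≤ (1 / 2) ^ (1 : ℝ) :=
      Real.rpow_le_rpow_of_exponent_ge (by norm_num) (by norm_num) hq
    rw [Real.mul_rpow hL.le (by norm_num)] at h2
    rw [Real.rpow_one] at h3
    have := mul_le_mul_of_nonneg_left h3 (Real.rpow_nonneg hL.le q)
    linarith
  · rw [div_le_div_iff₀ (by positivity) (by positivity)]
    nlinarith

end HardInstance

/-! ### Choice of parameters and combination of the instances -/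

/-- The constant of the lower bound, as a function of the moment exponent. -/
def rateConstant (p : ℝ) : ℝ := 1 / (2 ^ 20 * (1 + 8 ^ (1 / (p - 1))))

/-- The number `8` is `2 * 2 ^ 2`, an upper bound for the factor `2 * 2 ^ p`; the power `1 / (p -
1)` turns into `8⁻¹` under the exponent `1 - p`. -/
theorem moment_condition {p ε σ₁ : ℝ} (hp : 1 < p) (hp2 : p ≤ 2) (hε : 0 < ε) (hσ : 0 < σ₁) :
    2 * (2 * ε) ^ p * (8 ^ (1 / (p - 1)) / (σ₁ / ε) ^ (p / (p - 1))) ^ (1 - p) ≤ σ₁ ^ p := by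
  have hp1 : p - 1 ≠ 0 := by linarith
  have hs : 0 < σ₁ / ε := by positivity
  have h1 : ((8 : ℝ) ^ (1 / (p - 1))) ^ (1 - p) = 8⁻¹ := by
    rw [← Real.rpow_mul (by norm_num), show 1 / (p - 1) * (1 - p) = -1 by field_simp; ring,
      Real.rpow_neg_one]
  have h2 : ((σ₁ / ε) ^ (p / (p - 1))) ^ (1 - p) = ((σ₁ / ε) ^ p)⁻¹ := by
    rw [← Real.rpow_mul hs.le, show p / (p - 1) * (1 - p) = -p by field_simp; ring,
      Real.rpow_neg hs.le]
  have h3 : (2 : ℝ) ^ p ≤ 2 ^ (2 : ℝ) := Real.rpow_le_rpow_of_exponent_le (by norm_num) hp2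
  rw [Real.rpow_two] at h3
  rw [Real.div_rpow (by positivity) (by positivity), h1, h2, Real.div_rpow hσ.le hε.le,
    Real.mul_rpow (by norm_num) hε.le]
  have hε' : 0 < ε ^ p := by positivity
  have hσ' : 0 < σ₁ ^ p := by positivity
  calc _ = 2 ^ p * σ₁ ^ p / 4 := by field_simp; norm_num
    _ ≤ _ := by nlinarith

theorem rpow_inv_le_mul_rpow {s B q : ℝ} (hs : 0 < s) (hB : 1 ≤ B) (hq : 1 ≤ q) :
    s ^ (1 / q) ≤ (B / s) ^ ((q - 1) / q) * s := by
  have hq0 : 0 < q := by linarith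
  have hexp : 0 ≤ (q - 1) / q := div_nonneg (by linarith) hq0.le
  have h1 : s⁻¹ ^ ((q - 1) / q) ≤ (B / s) ^ ((q - 1) / q) := by
    refine Real.rpow_le_rpow (by positivity) ?_ hexp
    rw [← one_div]
    gcongr
  have h2 : s ^ (1 / q) = s⁻¹ ^ ((q - 1) / q) * s := by
    rw [Real.inv_rpow hs.le, ← Real.rpow_neg hs.le, ← Real.rpow_add_one hs.ne']
    congr 1
    field_simp
    ring
  rw [h2]
  gcongr

theorem hardInstance_lowerRate (K : ℕ) {p q ε L₁ Δ δ σ₁ : ℝ} (hp : 1 < p) (hp2 : p ≤ 2)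
    (hq : 1 ≤ q) (hΔ : 0 < Δ) (hL : 0 < L₁) (hδ : 0 < δ) (hσ : 0 ≤ σ₁) (hε : 0 < ε)
    (hεL : 256 ≤ L₁ * Δ / ε ^ 2) :
    HardInstance.{u} K p q ε L₁ Δ δ σ₁ (rateConstant p * lowerRate p q ε L₁ Δ δ σ₁) := by
  set B : ℝ := 8 ^ (1 / (p - 1)) with hB
  set s : ℝ := (σ₁ / ε) ^ (p / (p - 1)) with hs
  set a : ℝ := L₁ * Δ / ε ^ 2 with ha
  set R := lowerRate p q ε L₁ Δ δ σ₁
  have hB1 : 1 ≤ B := Real.one_le_rpow (by norm_num) (one_div_nonneg.2 (by linarith))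
  have hR1 : R ≤ a + a * s := min_le_left _ _
  have hmono : ∀ {X : ℝ}, R ≤ 2 ^ 20 * (1 + B) * X → rateConstant p * R ≤ X := fun {X} h => by
    rw [rateConstant, ← hB, one_div, inv_mul_le_iff₀ (by positivity)]
    exact h
  have hnl := hardInstance_noiseless.{u} (K := K) hp.le hq hε hL hδ.le hσ hεL
  rw [← ha] at hnl
  rcases lt_or_ge s B with hsB | hsB
  -- Here `θ = B / s` would exceed `1`, but the noise improves the first rate only by the factor `1
  -- + s < 1 + B`.
  · refine hnl.mono (hmono ?_)
    have := mul_lt_mul_of_pos_left hsB (show 0 < a by linarith)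
    nlinarith
  have hs0 : 0 < s := by linarith
  have hσ0 : 0 < σ₁ := by
    refine lt_of_le_of_ne hσ fun h => hs0.ne' ?_
    rw [hs, ← h, zero_div, Real.zero_rpow (div_ne_zero (by linarith) (by linarith))]
  have hmom := moment_condition hp hp2 hε hσ0
  rw [← hB, ← hs] at hmom
  set θ := B / s with hθ
  have hθ0 : 0 < θ := by positivity
  have hθ1 : θ ≤ 1 := (div_le_one hs0).2 hsB
  set η := θ ^ ((q - 1) / q) with hη
  have hη0 : 0 < η := by positivity
  -- The largest smoothness allowed: `L ≤ δ * η` amounts to `L ^ q * θ ^ (1 - q) ≤ δ ^ q`.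
  set L := min L₁ (δ * η) with hLdef
  have hL0 : 0 < L := lt_min hL (by positivity)
  set Q := L * Δ / ε ^ 2 with hQ
  have hQ0 : 0 < Q := by positivity
  -- The minimum defining `L` selects the branch of the rate: the first if `L = L₁`, the second
  -- otherwise. The three terms match the three instances.
  have hR2 : R ≤ a + s + 2 * (Q * s) := by
    rcases min_choice L₁ (δ * η) with h | h
    · have : Q = a := by rw [hQ, hLdef, h]
      rw [this]
      nlinarith
    · set b := δ * Δ / ε ^ 2 with hb
      have hb0 : 0 < b := by positivity
      have h1 : R ≤ s + (L₁ + δ) * Δ / ε ^ 2 +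
          b * (σ₁ / ε) ^ (p / (q * (p - 1))) := min_le_right _ _
      have h2 : (σ₁ / ε) ^ (p / (q * (p - 1))) = s ^ (1 / q) := by
        rw [hs, ← Real.rpow_mul (by positivity)]
        congr 1
        rw [div_mul_div_comm, mul_one, mul_comm q]
      have h3 : (L₁ + δ) * Δ / ε ^ 2 = a + b := by rw [ha, hb]; ring
      have h4 : 1 ≤ s ^ (1 / q) :=
        Real.one_le_rpow (hB1.trans hsB) (one_div_nonneg.2 (by linarith))
      have h5 : b * s ^ (1 / q) ≤ Q * s := by
        calc _ ≤ b * (η * s) := by gcongr; exact rpow_inv_le_mul_rpow hs0 hB1 hq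
          _ = Q * s := by rw [hQ, hLdef, h, hb]; ring
      rw [h2, h3] at h1
      nlinarith
  have hsingle := hardInstance_single.{u} (K := K) hp.le hq hε hL hδ.le hθ0 hθ1 hmom hεL
  have hsθ : 1 / (2 * θ) * B = s / 2 := by rw [hθ]; field_simp
  have key1 : R ≤ 514 * a → HardInstance.{u} K p q ε L₁ Δ δ σ₁ (rateConstant p * R) := fun h => by
    refine hnl.mono (hmono ?_)
    nlinarith
  -- The noisy chain has at least one link only if `256 ≤ Q`; otherwise `Q * s` is at most `256 * s`
  -- and is covered by the other two instances.
  rcases lt_or_ge Q 256 with hQ256 | hQ256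
  · have := mul_lt_mul_of_pos_right hQ256 hs0
    rcases le_total a s with h | h
    · refine hsingle.mono (hmono ?_)
      have : 0 < 1 / (2 * θ) := by positivity
      linarith
    · exact key1 (by linarith)
  · have hsQ : 256 * s ≤ Q * s := by gcongr
    rcases le_total a (Q * s) with h | h
    · have hchain := hardInstance_chain.{u} (K := K) (σ₁ := σ₁) (δ := δ) hp.le hq hε hL0
        (min_le_left _ _) hθ0 hθ1 hmom ?_ hQ256
      · refine hchain.mono (hmono ?_)
        rw [← hQ]
        have h1 : Q / (1024 * θ) * B = Q * s / 1024 := by rw [hθ]; field_simp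
        have h2 : 0 < Q / (1024 * θ) := by positivity
        linarith
      · have hle : L ^ q ≤ (δ * η) ^ q :=
          Real.rpow_le_rpow hL0.le (min_le_right _ _) (by linarith)
        rw [Real.mul_rpow hδ.le hη0.le, hη, ← Real.rpow_mul hθ0.le,
          div_mul_cancel₀ _ (by linarith)] at hle
        calc _ ≤ δ ^ q * θ ^ (q - 1) * θ ^ (1 - q) := by gcongr
          _ = δ ^ q := by
            rw [mul_assoc, ← Real.rpow_add hθ0]
            simp
    · exact key1 (by linarith)

end

theorem theorem2 :
    ∃ c₁ : ℝ, 0 < c₁ ∧ ∀ p q : ℝ, 1 < p → p ≤ 2 → 1 ≤ q → q ≤ 2 →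
      ∃ C : ℝ, 0 < C ∧ ∀ (K : ℕ) (Δ L₁ δ σ₁ ε : ℝ), 1 ≤ K →
        0 < Δ → 0 < L₁ → 0 < δ → 0 ≤ σ₁ → 0 < ε → ε ≤ c₁ * √(L₁ * Δ) →
          (∃ d : ℕ, 1 ≤ d ∧ ∃ F ∈ FunctionClass d Δ L₁, ∃ O ∈ OracleClass F p σ₁ q δ,
            ∀ A ∈ ZeroRespectingClass.{u} d K,
              ENNReal.ofReal (C * lowerRate p q ε L₁ Δ δ σ₁) ≤ A.complexity O ε) ∧
          ENNReal.ofReal (C * lowerRate p q ε L₁ Δ δ σ₁) ≤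
            zeroRespectingComplexity.{u} K p q ε L₁ Δ δ σ₁ := by
  -- With `1 / 16` one has `L₁ * Δ / ε ^ 2 ≥ 256`, enough for a chain of length at least one.
  refine ⟨1 / 16, by norm_num, fun p q hp hp2 hq _ => ⟨rateConstant p, ?_,
    fun K Δ L₁ δ σ₁ ε _ hΔ hL hδ hσ hε hεL => ?_⟩⟩
  · unfold rateConstant
    positivity
  have hLΔ : 0 < L₁ * Δ := by positivity
  have h256 : 256 ≤ L₁ * Δ / ε ^ 2 := by
    rw [le_div_iff₀ (by positivity)]
    have h1 := pow_le_pow_left₀ hε.le hεL 2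
    rw [mul_pow, Real.sq_sqrt hLΔ.le] at h1
    linarith
  have hhard := hardInstance_lowerRate.{u} K hp hp2 hq hΔ hL hδ hσ hε h256
  refine ⟨hhard, ?_⟩
  obtain ⟨d, hd, F, hF, O, hO, hA⟩ := hhard
  exact le_iSup₂_of_le d hd (le_iSup₂_of_le F hF (le_iSup₂_of_le O hO (le_iInf₂ hA)))
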